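/- A polytope is the convex hull of a nonempty finite set of points in a finite-dimensional Euclidean space; its dimension is that of its affine hull. A (nonempty) face of a polytope $Q$ is the set of points of $Q$ at which some linear functional attains its maximum over $Q$ (so $Q$ is a face of itself), a facet is a face of dimension $\dim Q-1$, and $f_k(Q)$ denotes the number of $k$-dimensional faces of $Q$. Every nonempty face $F$ of a Minkowski sum $P=P_1+\cdots+P_r$ of polytopes can be written uniquely as $F=F_1+\cdots+F_r$ with $F_i$ a nonempty face of $P_i$; this decomposition is called exact if $\dim F=\dim F_1+\cdots+\dim F_r$. The polytopes $P_1,\ldots,P_r$ are called relatively in general position if every facet of $P$ has an exact decomposition. Put $$f^\delta_k(P)=f_k(P)-\bigl(f_k(P_1)+\cdots+f_k(P_r)\bigr).$$ Let $P_1,\ldots,P_r$ be $d$-dimensional polytopes relatively in general position whose Minkowski sum $P=P_1+\cdots+P_r$ is also $d$-dimensional (for $r\ge 1$ this is automatic if the polytopes lie in $\mathbb{R}^d$). Then for every real number $a$, $$\sum_{k=0}^{d-1}(-1)^k (k+a)\, f^\delta_k(P) = a(1-r)\bigl(1-(-1)^d\bigr).$$ -/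

import Mathlib

open scoped Pointwise

namespace MinkowskiFaces

variable {E : Type*} [NormedAddCommGroup E] [InnerProductSpace ℝ E]

/-- A (nonempty, convex) polytope: the convex hull of a nonempty finite set of points. -/
def IsPolytope (P : Set E) : Prop :=
  ∃ s : Finset E, s.Nonempty ∧ P = convexHull ℝ (s : Set E)

/-- The dimension of a nonempty set: the dimension of its affine hull. -/
noncomputable def dim (A : Set E) : ℕ := Module.finrank ℝ (vectorSpan ℝ A)

/-- `F` is a nonempty face of `P`: the set of points of `P` at which some linear functional attains
its maximum over `P`. (The zero functional gives `P` itself.) -/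
def IsFace (P F : Set E) : Prop := F.Nonempty ∧ IsExposed ℝ P F

/-- `F` is a facet of `P`: a face whose dimension is one less than that of `P`. -/
def IsFacet (P F : Set E) : Prop := IsFace P F ∧ dim F + 1 = dim P

/-- The component `f_k(P)`, `k ≥ 0`, of the f-vector: the number of `k`-dimensional faces. -/
noncomputable def fVec (P : Set E) (k : ℕ) : ℕ := {F : Set E | IsFace P F ∧ dim F = k}.ncard

/-- `G 0, …, G (r - 1)` is a decomposition of the face `F` of the Minkowski sum `∑ i, P i`
into faces of the summands. -/
def IsDecomposition {r : ℕ} (P : Fin r → Set E) (F : Set E) (G : Fin r → Set E) : Prop :=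
  (∀ i, IsFace (P i) (G i)) ∧ F = ∑ i, G i

/-- The decomposition of `F` is exact: the dimension of `F` is the sum of the dimensions of the
faces into which `F` decomposes. (For polytopes the decomposition exists and is unique.) -/
def HasExactDecomposition {r : ℕ} (P : Fin r → Set E) (F : Set E) : Prop :=
  ∃ G : Fin r → Set E, IsDecomposition P F G ∧ dim F = ∑ i, dim (G i)

/-- The summands `P i` are relatively in general position: every facet of the Minkowski sum
has an exact decomposition. -/
def InRelativeGeneralPosition {r : ℕ} (P : Fin r → Set E) : Prop :=
  ∀ F : Set E, IsFacet (∑ i, P i) F → HasExactDecomposition P F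

/-- The component `f^δ_k` of the f^δ-vector of the face `∑ i, G i` of a Minkowski sum which
decomposes into the `G i`. The sum `∑ i, P i` itself decomposes into the `P i`. -/
noncomputable def fDelta {r : ℕ} (G : Fin r → Set E) (k : ℕ) : ℤ :=
  (fVec (∑ i, G i) k : ℤ) - ∑ i, (fVec (G i) k : ℤ)

end MinkowskiFaces

namespace MinkowskiFaces

open Module Filter Topology

/-! Sort the functionals by the face they expose. The relatively open normal cones of the faces of a
polytope in an `n`-dimensional space partition that space, and the cone of `F` has dimension `n -
dim F`. The sign `(-1) ^ dim` behaves like an Euler characteristic: it respects every linear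
relation between indicators of relatively open convex sets (`sum_mul_neg_one_pow_eq_zero`). Applied
to the whole normal fan this gives Euler's formula (`IsPolytope.sum_faces`).

The fan of the Minkowski sum refines that of each summand, so the cone of a face `G` of `P i` is the
union of the cones of those faces `F` of the sum whose `i`-th component is `G`. Hence the signs
`(-1) ^ dim F` over these `F` add up to `(-1) ^ dim G` (`sum_neg_one_pow_dim_component`).

General position passes from facets to all proper faces, because every proper face lies in a facet
and independence of direction spaces is inherited by subspaces. So `dim F` is the sum of the
dimensions of its components. Weighting by signs and grouping by components shows that the
alternating sum of dimensions over proper faces is additive (`sum_neg_one_pow_mul_dim`). This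
settles the part with factor `k`; Euler's formula settles the part with factor `a`. -/

/-- A nonempty convex set `C`, contained in a translate of the subspace `W` and open in it
along lines. -/
structure IsRelOpenConvex {V : Type*} [AddCommGroup V] [Module ℝ V]
    (W : Submodule ℝ V) (C : Set V) : Prop where
  nonempty : C.Nonempty
  convex : Convex ℝ C
  sub_mem : ∀ x ∈ C, ∀ y ∈ C, x - y ∈ W
  add_smul_mem : ∀ x ∈ C, ∀ w ∈ W, ∃ ε : ℝ, 0 < ε ∧ x + ε • w ∈ C

/-! ### Euler characteristic on the real line -/

theorem exists_pos_forall_add_lt (T : Finset ℝ) :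
    ∃ δ : ℝ, 0 < δ ∧ ∀ x ∈ T, ∀ y ∈ T, x < y → x + δ < y := by
  have h : ∀ᶠ δ : ℝ in 𝓝[>] 0, ∀ x ∈ T, ∀ y ∈ T, x < y → x + δ < y := by
    rw [Filter.eventually_all_finset]
    intro x _
    rw [Filter.eventually_all_finset]
    intro y _
    by_cases hxy : x < y
    · filter_upwards [Ioo_mem_nhdsGT (sub_pos.2 hxy)] with δ hδ _
      linarith [hδ.2]
    · exact Eventually.of_forall fun δ h => absurd h hxy
  obtain ⟨δ, h1, h2⟩ := (h.and self_mem_nhdsWithin).exists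
  exact ⟨δ, h2, h1⟩

theorem exists_mem_iff_coe_lt {I : Set ℝ} (hc : I.OrdConnected) (hl : ∀ x ∈ I, ∃ y ∈ I, y < x)
    (hr : ∀ x ∈ I, ∃ y ∈ I, x < y) :
    ∃ a b : EReal, ∀ x : ℝ, x ∈ I ↔ a < (x : EReal) ∧ (x : EReal) < b := by
  refine ⟨sInf ((↑) '' I), sSup ((↑) '' I), fun x => ⟨fun hx => ⟨?_, ?_⟩, ?_⟩⟩
  · obtain ⟨y, hy, hyx⟩ := hl x hx
    exact (sInf_le (Set.mem_image_of_mem _ hy)).trans_lt (EReal.coe_lt_coe_iff.2 hyx)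
  · obtain ⟨y, hy, hyx⟩ := hr x hx
    exact (EReal.coe_lt_coe_iff.2 hyx).trans_le (le_sSup (Set.mem_image_of_mem _ hy))
  · rintro ⟨h1, h2⟩
    obtain ⟨_, ⟨y, hy, rfl⟩, hyx⟩ := sInf_lt_iff.1 h1
    obtain ⟨_, ⟨z, hz, rfl⟩, hxz⟩ := lt_sSup_iff.1 h2
    exact hc.out hy hz ⟨(EReal.coe_lt_coe_iff.1 hyx).le, (EReal.coe_lt_coe_iff.1 hxz).le⟩

-- The expression is linear in the indicator of `I`: it samples `I` at each point of `T` and just to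
-- its right, and once at `M`, far to the left. A point of `T` is seen once, and no shifted sample
-- hits it.
open Classical in
theorem euler_sum_singleton {I : Set ℝ} {T : Finset ℝ} {δ M t : ℝ} (hI : I = {t}) (hδ : 0 < δ)
    (hT : ∀ x ∈ T, ∀ y ∈ T, x < y → x + δ < y) (hM : ∀ x ∈ T, M < x) (ht : t ∈ T) :
    ∑ x ∈ T, ((if x ∈ I then (1 : ℤ) else 0) - if x + δ ∈ I then 1 else 0)
      - (if M ∈ I then 1 else 0) = 1 := by
  have hmem : ∀ x, x ∈ I ↔ x = t := fun x => by rw [hI, Set.mem_singleton_iff]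
  have h1 : M ∉ I := fun h => (hM t ht).ne ((hmem M).1 h)
  have h2 : ∀ x ∈ T, x + δ ∉ I := fun x hx h => by
    have := (hmem _).1 h
    exact (hT x hx t ht (by linarith)).ne this
  rw [Finset.sum_sub_distrib, Finset.sum_congr rfl (fun x hx => if_neg (h2 x hx)), if_neg h1]
  simp [hmem, ht]

-- Only the left end counts: if finite, it is missed while its right shift is hit; if it is `-∞`,
-- the sample at `M` is hit. All other samples cancel in pairs. An infinite end has `toReal` equal
-- to `0`, which only adds a harmless point to `T`.
open Classical in
theorem euler_sum_interval {I : Set ℝ} {T : Finset ℝ} {δ M : ℝ} {a b : EReal}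
    (hI : ∀ x, x ∈ I ↔ a < (x : EReal) ∧ (x : EReal) < b) (hδ : 0 < δ)
    (hT : ∀ x ∈ T, ∀ y ∈ T, x < y → x + δ < y) (hM : ∀ x ∈ T, M < x)
    (hab : I.Nonempty) (ha : a.toReal ∈ T) (hb : b.toReal ∈ T) :
    ∑ x ∈ T, ((if x ∈ I then (1 : ℤ) else 0) - if x + δ ∈ I then 1 else 0)
      - (if M ∈ I then 1 else 0) = -1 := by
  obtain ⟨p, hp⟩ := hab
  obtain ⟨hp1, hp2⟩ := (hI p).1 hp
  have hbx : ∀ x ∈ T, ((x + δ : ℝ) : EReal) < b ↔ (x : EReal) < b := by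
    intro x hx
    induction b with
    | bot => simp at hp2
    | top => simp only [EReal.coe_lt_top]
    | coe b =>
      rw [EReal.coe_lt_coe_iff, EReal.coe_lt_coe_iff]
      exact ⟨fun h => by linarith, fun h => hT x hx b hb h⟩
  have hbM : (M : EReal) < b := by
    induction b with
    | bot => simp at hp2
    | top => exact EReal.coe_lt_top M
    | coe b => exact EReal.coe_lt_coe_iff.2 (hM b hb)
  induction a with
  | top => simp at hp1
  | bot =>
    rw [Finset.sum_eq_zero, if_pos ((hI M).2 ⟨EReal.bot_lt_coe M, hbM⟩), zero_sub]
    intro x hx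
    have : x + δ ∈ I ↔ x ∈ I := by
      rw [hI, hI, hbx x hx]
      simp only [EReal.bot_lt_coe, true_and]
    simp only [this, sub_self]
  | coe a =>
    have haT : a ∈ T := ha
    have hMI : M ∉ I := fun h => (hM a haT).not_gt (EReal.coe_lt_coe_iff.1 ((hI M).1 h).1)
    have haI : a ∉ I := fun h => lt_irrefl _ ((hI a).1 h).1
    have haI' : a + δ ∈ I := (hI _).2
      ⟨EReal.coe_lt_coe_iff.2 (by linarith), (hbx a haT).2 (hp1.trans hp2)⟩
    rw [Finset.sum_eq_single a, if_neg haI, if_pos haI', if_neg hMI]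
    · norm_num
    · intro x hx hxa
      have : x + δ ∈ I ↔ x ∈ I := by
        rw [hI, hI, hbx x hx, EReal.coe_lt_coe_iff, EReal.coe_lt_coe_iff]
        refine and_congr_left fun _ => ⟨fun h => ?_, fun h => by linarith⟩
        by_contra h'
        exact (hT x hx a haT (lt_of_le_of_ne (not_lt.1 h') hxa)).not_gt h
      simp only [this, sub_self]
    · exact fun h => absurd haT h

open Classical in
/-- The Euler relation on the real line. -/
theorem sum_mul_eq_zero_of_real {ι : Type*} (J : Finset ι) (c σ : ι → ℤ) (I : ι → Set ℝ)
    (h : ∀ j ∈ J, ((∃ t, I j = {t}) ∧ σ j = 1) ∨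
      ((I j).Nonempty ∧ (I j).OrdConnected ∧ (∀ x ∈ I j, ∃ y ∈ I j, y < x) ∧
        (∀ x ∈ I j, ∃ y ∈ I j, x < y)) ∧ σ j = -1)
    (hrel : ∀ t, ∑ j ∈ J, c j * (if t ∈ I j then 1 else 0) = 0) :
    ∑ j ∈ J, c j * σ j = 0 := by
  -- Any sample set containing the ends of `I j` computes `σ j`, so one common `T`, `δ`, `M` serves
  -- all `j` and the relation can be applied sample by sample.
  have key : ∀ j ∈ J, ∃ T : Finset ℝ, ∀ (T' : Finset ℝ) (δ M : ℝ), T ⊆ T' → 0 < δ →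
      (∀ x ∈ T', ∀ y ∈ T', x < y → x + δ < y) → (∀ x ∈ T', M < x) →
      ∑ x ∈ T', ((if x ∈ I j then (1 : ℤ) else 0) - if x + δ ∈ I j then 1 else 0)
        - (if M ∈ I j then 1 else 0) = σ j := by
    intro j hj
    rcases h j hj with ⟨⟨t, ht⟩, hσ⟩ | ⟨⟨hne, hc, hl, hr⟩, hσ⟩
    · refine ⟨{t}, fun T' δ M hT hδ h1 h2 => ?_⟩
      rw [hσ]
      exact euler_sum_singleton ht hδ h1 h2 (by simpa using hT)
    · obtain ⟨a, b, hI⟩ := exists_mem_iff_coe_lt hc hl hr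
      refine ⟨{a.toReal, b.toReal}, fun T' δ M hT hδ h1 h2 => ?_⟩
      rw [hσ]
      exact euler_sum_interval hI hδ h1 h2 hne (hT (by simp)) (hT (by simp))
  choose! T hT using key
  obtain ⟨δ, hδ, hδT⟩ := exists_pos_forall_add_lt (J.biUnion T)
  obtain ⟨M, hM⟩ : ∃ M : ℝ, ∀ x ∈ J.biUnion T, M < x := by
    obtain ⟨m, hm⟩ := (J.biUnion T).bddBelow
    exact ⟨m - 1, fun x hx => by linarith [hm hx]⟩
  have hs : ∀ j ∈ J, c j * σ j = ∑ x ∈ J.biUnion T, (c j * (if x ∈ I j then 1 else 0)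
      - c j * (if x + δ ∈ I j then 1 else 0)) - c j * (if M ∈ I j then 1 else 0) := by
    intro j hj
    rw [← hT j hj _ δ M (Finset.subset_biUnion_of_mem T hj) hδ hδT hM, mul_sub, Finset.mul_sum]
    simp only [mul_sub]
  rw [Finset.sum_congr rfl hs, Finset.sum_sub_distrib, hrel M, Finset.sum_comm,
    Finset.sum_eq_zero, sub_zero]
  intro x _
  rw [Finset.sum_sub_distrib, hrel, hrel, sub_zero]

/-! ### Euler relation in any dimension, by slicing -/

section Slice

variable {V : Type*} [AddCommGroup V] [Module ℝ V]

theorem IsRelOpenConvex.slice {W : Submodule ℝ V} {C : Set V} (h : IsRelOpenConvex W C)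
    (π : V →ₗ[ℝ] ℝ) {t : ℝ} (ht : t ∈ π '' C) :
    IsRelOpenConvex (W ⊓ LinearMap.ker π) (C ∩ π ⁻¹' {t}) where
  nonempty := by
    obtain ⟨x, hx, rfl⟩ := ht
    exact ⟨x, hx, rfl⟩
  convex := h.convex.inter ((convex_singleton t).linear_preimage π)
  sub_mem := by
    rintro x ⟨hx, hxt⟩ y ⟨hy, hyt⟩
    refine ⟨h.sub_mem x hx y hy, ?_⟩
    simp only [Set.mem_preimage, Set.mem_singleton_iff] at hxt hyt
    simp [hxt, hyt]
  add_smul_mem := by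
    rintro x ⟨hx, hxt⟩ w ⟨hw, hwt⟩
    obtain ⟨ε, hε, hm⟩ := h.add_smul_mem x hx w hw
    refine ⟨ε, hε, hm, ?_⟩
    simp only [Set.mem_preimage, Set.mem_singleton_iff] at hxt ⊢
    simp only [SetLike.mem_coe, LinearMap.mem_ker] at hwt
    simp [hxt, hwt]

theorem IsRelOpenConvex.image_eq_singleton {W : Submodule ℝ V} {C : Set V}
    (h : IsRelOpenConvex W C) {π : V →ₗ[ℝ] ℝ} (hW : W ≤ LinearMap.ker π) :
    ∃ t, π '' C = {t} := by
  obtain ⟨x, hx⟩ := h.nonempty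
  refine ⟨π x, Set.eq_singleton_iff_unique_mem.2 ⟨⟨x, hx, rfl⟩, ?_⟩⟩
  rintro _ ⟨y, hy, rfl⟩
  have := hW (h.sub_mem y hy x hx)
  rw [LinearMap.mem_ker, map_sub] at this
  linarith

theorem IsRelOpenConvex.exists_lt {W : Submodule ℝ V} {C : Set V}
    (h : IsRelOpenConvex W C) {π : V →ₗ[ℝ] ℝ} (hW : ¬ W ≤ LinearMap.ker π) :
    (∀ x ∈ π '' C, ∃ y ∈ π '' C, y < x) ∧ (∀ x ∈ π '' C, ∃ y ∈ π '' C, x < y) := by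
  obtain ⟨w, hw, hπ⟩ := SetLike.not_le_iff_exists.1 hW
  have hπ : π w ≠ 0 := hπ
  constructor
  · rintro _ ⟨x, hx, rfl⟩
    obtain ⟨ε, hε, hm⟩ := h.add_smul_mem x hx (-(π w) • w) (W.smul_mem _ hw)
    refine ⟨_, ⟨_, hm, rfl⟩, ?_⟩
    have : 0 < ε * (π w * π w) := mul_pos hε (mul_self_pos.2 hπ)
    simp only [map_add, map_smul, smul_eq_mul]
    linarith
  · rintro _ ⟨x, hx, rfl⟩
    obtain ⟨ε, hε, hm⟩ := h.add_smul_mem x hx (π w • w) (W.smul_mem _ hw)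
    refine ⟨_, ⟨_, hm, rfl⟩, ?_⟩
    have : 0 < ε * (π w * π w) := mul_pos hε (mul_self_pos.2 hπ)
    simp only [map_add, map_smul, smul_eq_mul]
    linarith

theorem finrank_inf_ker_add_one [FiniteDimensional ℝ V] {W : Submodule ℝ V} {π : V →ₗ[ℝ] ℝ}
    (hW : ¬ W ≤ LinearMap.ker π) :
    finrank ℝ (W ⊓ LinearMap.ker π : Submodule ℝ V) + 1 = finrank ℝ W := by
  have hne : π.domRestrict W ≠ 0 := by
    intro h0
    exact hW fun w hw => LinearMap.congr_fun h0 ⟨w, hw⟩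
  rw [← Module.Dual.finrank_ker_add_one_of_ne_zero (f := π.domRestrict W) hne,
    LinearMap.ker_domRestrict, ← Submodule.map_comap_subtype]
  congr 1
  exact (Submodule.equivMapOfInjective _ W.injective_subtype _).finrank_eq.symm

-- A Fubini argument, by induction on a subspace `K` containing all differences: the relation
-- restricts to each fibre of a functional `π`, and the signs of the fibres then satisfy a relation
-- on the line.
open Classical in
theorem sum_mul_neg_one_pow_eq_zero_aux [FiniteDimensional ℝ V] {ι : Type*} (n : ℕ) :
    ∀ (K : Submodule ℝ V) (J : Finset ι) (c : ι → ℤ) (C : ι → Set V) (W : ι → Submodule ℝ V),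
    finrank ℝ K ≤ n → (∀ j ∈ J, IsRelOpenConvex (W j) (C j)) →
    (∀ i ∈ J, ∀ j ∈ J, ∀ x ∈ C i, ∀ y ∈ C j, x - y ∈ K) →
    (∀ x, ∑ j ∈ J, c j * (if x ∈ C j then 1 else 0) = 0) →
    ∑ j ∈ J, c j * (-1) ^ finrank ℝ (W j) = 0 := by
  induction n with
  | zero =>
    intro K J c C W hK hC hsub hrel
    rcases J.eq_empty_or_nonempty with rfl | ⟨i, hi⟩
    · simp
    have hK0 : K = ⊥ := Submodule.finrank_eq_zero.1 (Nat.le_zero.1 hK)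
    obtain ⟨x, hx⟩ := (hC i hi).nonempty
    have hall : ∀ j ∈ J, ∀ y ∈ C j, y = x := fun j hj y hy => by
      have := hsub j hj i hi y hy x hx
      rw [hK0, Submodule.mem_bot] at this
      exact sub_eq_zero.1 this
    rw [← hrel x]
    refine Finset.sum_congr rfl fun j hj => ?_
    obtain ⟨y, hy⟩ := (hC j hj).nonempty
    have hxj : x ∈ C j := hall j hj y hy ▸ hy
    have hW : W j = ⊥ := by
      rw [eq_bot_iff]
      intro w hw
      obtain ⟨ε, hε, hm⟩ := (hC j hj).add_smul_mem x hxj w hw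
      have := hall j hj _ hm
      simpa [hε.ne'] using this
    rw [if_pos hxj, hW, finrank_bot, pow_zero]
  | succ n ih =>
    intro K J c C W hK hC hsub hrel
    by_cases hKn : finrank ℝ K ≤ n
    · exact ih K J c C W hKn hC hsub hrel
    have hpos : 0 < finrank ℝ K := by omega
    obtain ⟨⟨v, hv⟩, hv0⟩ := (Module.finrank_pos_iff_exists_ne_zero (R := ℝ)).1 hpos
    have hv0' : v ≠ 0 := fun h => hv0 (Subtype.ext h)
    -- `π` is nonzero on `K`, so its fibres have directions in a smaller subspace.
    obtain ⟨π, hπ⟩ : ∃ π : V →ₗ[ℝ] ℝ, π v ≠ 0 := Module.Projective.exists_dual_ne_zero ℝ hv0'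
    have hKπ : finrank ℝ (K ⊓ LinearMap.ker π : Submodule ℝ V) ≤ n := by
      have := finrank_inf_ker_add_one (W := K) (π := π) fun h => hπ (h hv)
      omega
    have hslice : ∀ t : ℝ, ∑ j ∈ J,
        (c j * (-1) ^ finrank ℝ (W j ⊓ LinearMap.ker π : Submodule ℝ V)) *
          (if t ∈ π '' C j then 1 else 0) = 0 := by
      intro t
      have := ih (K ⊓ LinearMap.ker π) (J.filter fun j => t ∈ π '' C j) c
        (fun j => C j ∩ π ⁻¹' {t}) (fun j => W j ⊓ LinearMap.ker π) hKπ ?_ ?_ ?_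
      · simpa only [Finset.sum_filter, mul_ite, mul_one, mul_zero] using this
      · intro j hj
        rw [Finset.mem_filter] at hj
        exact (hC j hj.1).slice π hj.2
      · rintro i hi j hj x ⟨hx, hxt⟩ y ⟨hy, hyt⟩
        refine ⟨hsub i (Finset.mem_filter.1 hi).1 j (Finset.mem_filter.1 hj).1 x hx y hy, ?_⟩
        simp only [Set.mem_preimage, Set.mem_singleton_iff] at hxt hyt
        simp [hxt, hyt]
      · intro x
        by_cases hxt : π x = t
        · refine Eq.trans ?_ (hrel x)
          rw [Finset.sum_filter]
          refine Finset.sum_congr rfl fun j _ => ?_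
          by_cases hx : x ∈ C j
          · have h1 : t ∈ π '' C j := ⟨x, hx, hxt⟩
            have h2 : x ∈ C j ∩ π ⁻¹' {t} := ⟨hx, hxt⟩
            rw [if_pos h1, if_pos h2, if_pos hx]
          · have h2 : x ∉ C j ∩ π ⁻¹' {t} := fun h => hx h.1
            simp only [if_neg h2, if_neg hx, mul_zero, ite_self]
        · refine Finset.sum_eq_zero fun j _ => ?_
          have h2 : x ∉ C j ∩ π ⁻¹' {t} := fun h => hxt h.2
          rw [if_neg h2, mul_zero]
    -- The image of `C j` is a point (sign `1`, slicing keeps the dimension) or an open interval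
    -- (sign `-1`, slicing lowers it by one).
    rw [← sum_mul_eq_zero_of_real J _ (fun j => if W j ≤ LinearMap.ker π then 1 else -1)
      (fun j => π '' C j) ?_ hslice]
    · refine Finset.sum_congr rfl fun j _ => ?_
      by_cases hW : W j ≤ LinearMap.ker π
      · rw [if_pos hW, inf_eq_left.2 hW, mul_one]
      · rw [if_neg hW, ← finrank_inf_ker_add_one hW, pow_succ, mul_assoc]
    · intro j hj
      by_cases hW : W j ≤ LinearMap.ker π
      · exact Or.inl ⟨(hC j hj).image_eq_singleton hW, if_pos hW⟩
      · exact Or.inr ⟨⟨(hC j hj).nonempty.image π,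
          ((hC j hj).convex.linear_image π).ordConnected, (hC j hj).exists_lt hW⟩, if_neg hW⟩

open Classical in
/-- The Euler relation: a linear relation between the indicator functions of relatively open
convex sets is inherited by the signs `(-1) ^ dim`. -/
theorem sum_mul_neg_one_pow_eq_zero [FiniteDimensional ℝ V] {ι : Type*} (J : Finset ι)
    (c : ι → ℤ) (C : ι → Set V) (W : ι → Submodule ℝ V)
    (hC : ∀ j ∈ J, IsRelOpenConvex (W j) (C j))
    (hrel : ∀ x, ∑ j ∈ J, c j * (if x ∈ C j then 1 else 0) = 0) :
    ∑ j ∈ J, c j * (-1) ^ finrank ℝ (W j) = 0 :=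
  sum_mul_neg_one_pow_eq_zero_aux _ ⊤ J c C W le_rfl hC (fun _ _ _ _ _ _ _ _ => trivial) hrel

open Classical in
/-- The Euler relation for a partition of a relatively open convex set into such sets. -/
theorem neg_one_pow_finrank_eq_sum [FiniteDimensional ℝ V] {ι : Type*} (J : Finset ι)
    {C₀ : Set V} {W₀ : Submodule ℝ V} (h₀ : IsRelOpenConvex W₀ C₀)
    (C : ι → Set V) (W : ι → Submodule ℝ V) (hC : ∀ j ∈ J, IsRelOpenConvex (W j) (C j))
    (hsub : ∀ j ∈ J, C j ⊆ C₀) (hex : ∀ x ∈ C₀, ∃! j, j ∈ J ∧ x ∈ C j) :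
    (-1 : ℤ) ^ finrank ℝ W₀ = ∑ j ∈ J, (-1) ^ finrank ℝ (W j) := by
  -- The extra index `none` carries `C₀` with coefficient `-1`.
  have h := sum_mul_neg_one_pow_eq_zero (Finset.insertNone J)
    (fun o => o.elim (-1) fun _ => 1) (fun o => o.elim C₀ C) (fun o => o.elim W₀ W) ?_ ?_
  · rw [Finset.sum_insertNone] at h
    change -1 * (-1 : ℤ) ^ finrank ℝ W₀ + ∑ j ∈ J, 1 * (-1 : ℤ) ^ finrank ℝ (W j) = 0 at h
    simp only [one_mul] at h
    linarith
  · rintro (_ | j) hj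
    · exact h₀
    · exact hC j (Finset.some_mem_insertNone.1 hj)
  · intro x
    rw [Finset.sum_insertNone]
    change -1 * (if x ∈ C₀ then (1 : ℤ) else 0) + ∑ j ∈ J, 1 * (if x ∈ C j then 1 else 0) = 0
    simp only [one_mul]
    by_cases hx : x ∈ C₀
    · obtain ⟨i, ⟨hi, hxi⟩, hu⟩ := hex x hx
      rw [if_pos hx, Finset.sum_eq_single_of_mem i hi, if_pos hxi]
      · norm_num
      · exact fun j hj hji => if_neg fun hxj => hji (hu j ⟨hj, hxj⟩)
    · rw [if_neg hx, Finset.sum_eq_zero fun j hj => if_neg fun h => hx (hsub j hj h)]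
      norm_num

end Slice

/-! ### Independence of subspaces through dimensions -/

section Independence

variable {ι V : Type*} [Fintype ι] [AddCommGroup V] [Module ℝ V]

/-- The sum map from the product of a family of subspaces. -/
noncomputable def sumMap (W : ι → Submodule ℝ V) : (∀ i, W i) →ₗ[ℝ] V :=
  ∑ i, (W i).subtype ∘ₗ LinearMap.proj i

theorem sumMap_apply (W : ι → Submodule ℝ V) (v : ∀ i, W i) :
    sumMap W v = ∑ i, (v i : V) := by
  simp [sumMap]

theorem range_sumMap (W : ι → Submodule ℝ V) : LinearMap.range (sumMap W) = ⨆ i, W i := by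
  classical
  refine le_antisymm ?_ (iSup_le fun i w hw => ?_)
  · rintro _ ⟨v, rfl⟩
    rw [sumMap_apply]
    exact Submodule.sum_mem _ fun i _ => Submodule.mem_iSup_of_mem i (v i).2
  · refine ⟨Pi.single i ⟨w, hw⟩, ?_⟩
    rw [sumMap_apply, Finset.sum_eq_single i]
    · simp
    · intro j _ hj
      simp [hj]
    · simp

/-- Rank-nullity for the sum map: both sides say that its kernel is trivial. -/
theorem finrank_iSup_eq_sum_iff [FiniteDimensional ℝ V] (W : ι → Submodule ℝ V) :
    finrank ℝ (⨆ i, W i : Submodule ℝ V) = ∑ i, finrank ℝ (W i) ↔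
      ∀ v : ι → V, (∀ i, v i ∈ W i) → ∑ i, v i = 0 → ∀ i, v i = 0 := by
  have h := (sumMap W).finrank_range_add_finrank_ker
  rw [range_sumMap, Module.finrank_pi_fintype] at h
  have h2 : finrank ℝ (⨆ i, W i : Submodule ℝ V) = ∑ i, finrank ℝ (W i) ↔
      LinearMap.ker (sumMap W) = ⊥ := by
    rw [← Submodule.finrank_eq_zero (R := ℝ)]
    omega
  rw [h2, LinearMap.ker_eq_bot']
  constructor
  · intro h v hv hs i
    have := h (fun i => ⟨v i, hv i⟩) (by rw [sumMap_apply]; exact hs)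
    exact congrArg Subtype.val (congrFun this i)
  · intro h v hv
    rw [sumMap_apply] at hv
    funext i
    exact Subtype.ext (h (fun i => v i) (fun i => (v i).2) hv i)

theorem finrank_iSup_eq_sum_mono [FiniteDimensional ℝ V] {W W' : ι → Submodule ℝ V} (hW : ∀ i, W' i ≤ W i)
    (h : finrank ℝ (⨆ i, W i : Submodule ℝ V) = ∑ i, finrank ℝ (W i)) :
    finrank ℝ (⨆ i, W' i : Submodule ℝ V) = ∑ i, finrank ℝ (W' i) := by
  rw [finrank_iSup_eq_sum_iff] at h ⊢
  exact fun v hv => h v fun i => hW i (hv i)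

end Independence

/-! ### Exposed faces and their normal cones -/

section MaxFace

variable {E : Type*} [NormedAddCommGroup E] [InnerProductSpace ℝ E]

/-- The set of points of `P` at which the functional `⟪y, ·⟫` attains its maximum over `P`. -/
def maxFace (y : E) (P : Set E) : Set E :=
  {x | x ∈ P ∧ ∀ z ∈ P, inner ℝ y z ≤ inner ℝ y x}

theorem maxFace_subset (y : E) (P : Set E) : maxFace y P ⊆ P := fun _ hx => hx.1

theorem inner_eq_of_mem_maxFace {y : E} {P : Set E} {x z : E} (hx : x ∈ maxFace y P)
    (hz : z ∈ maxFace y P) : inner ℝ y x = inner ℝ y z :=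
  le_antisymm (hz.2 x hx.1) (hx.2 z hz.1)

theorem mem_maxFace_of_le {y : E} {P : Set E} {x z : E} (hx : x ∈ maxFace y P)
    (hz : z ∈ P) (h : inner ℝ y x ≤ inner ℝ y z) : z ∈ maxFace y P :=
  ⟨hz, fun w hw => (hx.2 w hw).trans h⟩

theorem mem_orthogonal_vectorSpan {y : E} {A : Set E} :
    y ∈ (vectorSpan ℝ A)ᗮ ↔ ∀ a ∈ A, ∀ b ∈ A, inner ℝ y a = inner ℝ y b := by
  rw [Submodule.mem_orthogonal']
  constructor
  · intro h a ha b hb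
    have := h _ (vsub_mem_vectorSpan ℝ ha hb)
    rw [vsub_eq_sub, inner_sub_right] at this
    linarith
  · intro h u hu
    have hle : vectorSpan ℝ A ≤ LinearMap.ker (innerₛₗ ℝ y) := by
      rw [vectorSpan_def, Submodule.span_le]
      rintro _ ⟨a, ha, b, hb, rfl⟩
      simp only [SetLike.mem_coe, LinearMap.mem_ker, innerₛₗ_apply_apply, vsub_eq_sub,
        inner_sub_right, h a ha b hb, sub_self]
    exact hle hu

theorem mem_orthogonal_of_mem_maxFace (y : E) (P : Set E) :
    y ∈ (vectorSpan ℝ (maxFace y P))ᗮ :=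
  mem_orthogonal_vectorSpan.2 fun _ ha _ hb => inner_eq_of_mem_maxFace ha hb

theorem maxFace_eq_self_iff {y : E} {P : Set E} :
    maxFace y P = P ↔ y ∈ (vectorSpan ℝ P)ᗮ := by
  constructor
  · intro h
    have := mem_orthogonal_of_mem_maxFace y P
    rwa [h] at this
  · intro h
    rw [mem_orthogonal_vectorSpan] at h
    exact Set.Subset.antisymm (maxFace_subset y P) fun x hx => ⟨hx, fun z hz => (h z hz x hx).le⟩

theorem IsPolytope.nonempty {P : Set E} (hP : IsPolytope P) : P.Nonempty := by
  obtain ⟨s, hs, rfl⟩ := hP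
  exact hs.to_set.convexHull

theorem IsPolytope.convex {P : Set E} (hP : IsPolytope P) : Convex ℝ P := by
  obtain ⟨s, hs, rfl⟩ := hP
  exact convex_convexHull ℝ _

theorem IsPolytope.isCompact {P : Set E} (hP : IsPolytope P) : IsCompact P := by
  obtain ⟨s, hs, rfl⟩ := hP
  exact s.finite_toSet.isCompact_convexHull ℝ

theorem inner_le_of_mem_convexHull {s : Set E} {u : E} {c : ℝ} (h : ∀ v ∈ s, inner ℝ u v ≤ c) :
    ∀ x ∈ convexHull ℝ s, inner ℝ u x ≤ c := by
  have : convexHull ℝ s ⊆ {x | innerₛₗ ℝ u x ≤ c} :=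
    convexHull_min h (convex_halfSpace_le (innerₛₗ ℝ u).isLinear c)
  exact this

theorem IsPolytope.maxFace_nonempty {P : Set E} (hP : IsPolytope P) (y : E) :
    (maxFace y P).Nonempty := by
  obtain ⟨x, hx, hmax⟩ := hP.isCompact.exists_isMaxOn hP.nonempty
    (f := fun x => inner ℝ y x) (by fun_prop)
  exact ⟨x, hx, fun z hz => hmax hz⟩

theorem isFace_iff [FiniteDimensional ℝ E] {P F : Set E} (hP : IsPolytope P) :
    IsFace P F ↔ ∃ y, maxFace y P = F := by
  constructor
  · rintro ⟨hne, hexp⟩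
    obtain ⟨l, rfl⟩ := hexp hne
    refine ⟨(InnerProductSpace.toDual ℝ E).symm l, ?_⟩
    simp only [maxFace, InnerProductSpace.toDual_symm_apply]
  · rintro ⟨y, rfl⟩
    exact ⟨hP.maxFace_nonempty y, fun _ => ⟨innerSL ℝ y, rfl⟩⟩

/-- If the slack of `y'` is bounded below on the vertices by a positive multiple of the slack
of `y`, then `y'` exposes a face contained in the one exposed by `y`. -/
theorem maxFace_subset_maxFace_of_slack {s : Set E} {y y' x₀ x₁ : E} {c : ℝ} (hc : 0 < c)
    (hx₀ : x₀ ∈ maxFace y (convexHull ℝ s)) (hx₁ : x₁ ∈ maxFace y' (convexHull ℝ s))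
    (h : ∀ v ∈ s, c * (inner ℝ y x₀ - inner ℝ y v) ≤ inner ℝ y' x₁ - inner ℝ y' v) :
    maxFace y' (convexHull ℝ s) ⊆ maxFace y (convexHull ℝ s) := by
  intro x hx
  refine mem_maxFace_of_le hx₀ hx.1 ?_
  -- The slack hypothesis bounds `y' - c • y` on the vertices, hence on the hull.
  have h1 := inner_le_of_mem_convexHull (s := s) (u := y' - c • y)
    (c := inner ℝ y' x₁ - c * inner ℝ y x₀) (fun v hv => by
      rw [inner_sub_left, real_inner_smul_left]; linarith [h v hv]) x hx.1
  rw [inner_sub_left, real_inner_smul_left, inner_eq_of_mem_maxFace hx hx₁] at h1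
  have : c * inner ℝ y x₀ ≤ c * inner ℝ y x := by linarith
  exact le_of_mul_le_mul_left this hc

/-- A face is determined by the generators it contains, whence finiteness of the set of faces.
Generators off the face of `y'` have positive `y'`-slack, so a small multiple of the `y`-slack stays
below it. -/
theorem maxFace_subset_of_inter_subset {s : Finset E} {y y' : E}
    (hy : (maxFace y (convexHull ℝ (s : Set E))).Nonempty)
    (hy' : (maxFace y' (convexHull ℝ (s : Set E))).Nonempty)
    (h : ∀ v ∈ s, v ∈ maxFace y' (convexHull ℝ (s : Set E)) →
      v ∈ maxFace y (convexHull ℝ (s : Set E))) :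
    maxFace y' (convexHull ℝ (s : Set E)) ⊆ maxFace y (convexHull ℝ (s : Set E)) := by
  obtain ⟨x₀, hx₀⟩ := hy
  obtain ⟨x₁, hx₁⟩ := hy'
  have hev : ∀ᶠ c : ℝ in 𝓝[>] 0, ∀ v ∈ s,
      c * (inner ℝ y x₀ - inner ℝ y v) ≤ inner ℝ y' x₁ - inner ℝ y' v := by
    rw [Filter.eventually_all_finset]
    intro v hv
    have hvP := subset_convexHull ℝ (s : Set E) hv
    by_cases hv' : v ∈ maxFace y' (convexHull ℝ (s : Set E))
    · refine Eventually.of_forall fun c => ?_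
      rw [inner_eq_of_mem_maxFace hx₀ (h v hv hv'), inner_eq_of_mem_maxFace hx₁ hv']
      simp
    · have hpos : 0 < inner ℝ y' x₁ - inner ℝ y' v := by
        by_contra hn
        exact hv' (mem_maxFace_of_le hx₁ hvP (by linarith))
      have ht : Tendsto (fun c : ℝ => c * (inner ℝ y x₀ - inner ℝ y v)) (𝓝[>] 0) (𝓝 0) := by
        have : Continuous fun c : ℝ => c * (inner ℝ y x₀ - inner ℝ y v) := by fun_prop
        simpa using (this.tendsto 0).mono_left nhdsWithin_le_nhds
      exact (ht.eventually_lt_const hpos).mono fun c hc => hc.le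
  obtain ⟨c, hc, hc0⟩ := (hev.and self_mem_nhdsWithin).exists
  exact maxFace_subset_maxFace_of_slack hc0 hx₀ hx₁ hc

theorem IsPolytope.finite_faces [FiniteDimensional ℝ E] {P : Set E} (hP : IsPolytope P) :
    {F | IsFace P F}.Finite := by
  have hP' := hP
  obtain ⟨s, hs, rfl⟩ := hP
  refine Set.Finite.of_finite_image (f := fun F => (s : Set E) ∩ F)
    ((s.finite_toSet.finite_subsets).subset ?_) ?_
  · rintro _ ⟨F, _, rfl⟩
    exact Set.inter_subset_left
  · intro F hF F' hF' h
    obtain ⟨y, rfl⟩ := (isFace_iff hP').1 hF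
    obtain ⟨y', rfl⟩ := (isFace_iff hP').1 hF'
    have h : (s : Set E) ∩ _ = (s : Set E) ∩ _ := h
    refine Set.Subset.antisymm
      (maxFace_subset_of_inter_subset (hP'.maxFace_nonempty _) (hP'.maxFace_nonempty _)
        fun v hv hvF => ?_)
      (maxFace_subset_of_inter_subset (hP'.maxFace_nonempty _) (hP'.maxFace_nonempty _)
        fun v hv hvF => ?_)
    · exact (h.subset ⟨hv, hvF⟩).2
    · exact (h.superset ⟨hv, hvF⟩).2

theorem maxFace_convexComb {P : Set E} {y y' : E} {a b : ℝ} (ha : 0 < a) (hb : 0 ≤ b)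
    (h : maxFace y P ⊆ maxFace y' P) (hne : (maxFace y P).Nonempty) :
    maxFace (a • y + b • y') P = maxFace y P := by
  have hi : ∀ z, inner ℝ (a • y + b • y') z = a * inner ℝ y z + b * inner ℝ y' z := fun z => by
    rw [inner_add_left, real_inner_smul_left, real_inner_smul_left]
  obtain ⟨z, hz⟩ := hne
  ext x
  constructor
  · rintro ⟨hx, hmax⟩
    refine mem_maxFace_of_le hz hx ?_
    have h1 := hmax z hz.1
    rw [hi, hi] at h1
    have h2 := mul_le_mul_of_nonneg_left ((h hz).2 x hx) hb
    exact le_of_mul_le_mul_left (by linarith) ha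
  · intro hx
    refine ⟨hx.1, fun w hw => ?_⟩
    rw [hi, hi]
    exact add_le_add (mul_le_mul_of_nonneg_left (hx.2 w hw) ha.le)
      (mul_le_mul_of_nonneg_left ((h hx).2 w hw) hb)

/-- The relatively open normal cone of a face. -/
theorem IsPolytope.isRelOpenConvex_normalCone {P : Set E} (hP : IsPolytope P) (y₀ : E) :
    IsRelOpenConvex (vectorSpan ℝ (maxFace y₀ P))ᗮ {y | maxFace y P = maxFace y₀ P} where
  nonempty := ⟨y₀, rfl⟩
  convex := by
    intro y hy y' hy' a b ha hb hab
    have hy : maxFace y P = _ := hy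
    have hy' : maxFace y' P = _ := hy'
    change maxFace (a • y + b • y') P = _
    rcases ha.eq_or_lt with rfl | ha
    · have : b = 1 := by linarith
      simpa [this] using hy'
    · rw [maxFace_convexComb ha hb (hy.trans hy'.symm).subset (hP.maxFace_nonempty y), hy]
  sub_mem := by
    intro y hy y' hy'
    have hy : maxFace y P = _ := hy
    have hy' : maxFace y' P = _ := hy'
    refine Submodule.sub_mem _ ?_ ?_
    · rw [← hy]; exact mem_orthogonal_of_mem_maxFace y P
    · rw [← hy']; exact mem_orthogonal_of_mem_maxFace y' P
  add_smul_mem := by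
    intro y hy w hw
    have hy : maxFace y P = _ := hy
    rw [← hy, mem_orthogonal_vectorSpan] at hw
    simp only [← hy]
    clear hy
    have hP' := hP
    obtain ⟨s, hs, rfl⟩ := hP
    obtain ⟨x₀, hx₀⟩ := hP'.maxFace_nonempty y
    -- For small `ε` the perturbation uses up at most half of each positive slack; on the face
    -- itself `w` is constant.
    have hev : ∀ᶠ ε : ℝ in 𝓝[>] 0, ∀ v ∈ s, (1 / 2) * (inner ℝ y x₀ - inner ℝ y v) ≤
        inner ℝ (y + ε • w) x₀ - inner ℝ (y + ε • w) v := by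
      rw [Filter.eventually_all_finset]
      intro v hv
      have hi : ∀ (ε : ℝ) z, inner ℝ (y + ε • w) z = inner ℝ y z + ε * inner ℝ w z :=
        fun ε z => by rw [inner_add_left, real_inner_smul_left]
      by_cases hv' : v ∈ maxFace y (convexHull ℝ (s : Set E))
      · refine Eventually.of_forall fun ε => ?_
        rw [hi, hi, inner_eq_of_mem_maxFace hx₀ hv', hw x₀ hx₀ v hv']
        simp
      · have hpos : 0 < inner ℝ y x₀ - inner ℝ y v := by
          by_contra hn
          exact hv' (mem_maxFace_of_le hx₀ (subset_convexHull ℝ (s : Set E) hv) (by linarith))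
        have ht : Tendsto (fun ε : ℝ => ε * (inner ℝ w v - inner ℝ w x₀)) (𝓝[>] 0) (𝓝 0) := by
          have : Continuous fun ε : ℝ => ε * (inner ℝ w v - inner ℝ w x₀) := by fun_prop
          simpa using (this.tendsto 0).mono_left nhdsWithin_le_nhds
        filter_upwards [ht.eventually_lt_const (half_pos hpos)] with ε hε
        rw [hi, hi]
        linarith
    obtain ⟨ε, hε, hε0⟩ := (hev.and self_mem_nhdsWithin).exists
    refine ⟨ε, hε0, ?_⟩
    have hx₁ : x₀ ∈ maxFace (y + ε • w) (convexHull ℝ (s : Set E)) := by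
      refine ⟨hx₀.1, inner_le_of_mem_convexHull fun v hv => ?_⟩
      have := hε v hv
      have := hx₀.2 v (subset_convexHull ℝ (s : Set E) hv)
      linarith
    refine Set.Subset.antisymm (maxFace_subset_maxFace_of_slack one_half_pos hx₀ hx₁ hε) ?_
    intro x hx
    refine mem_maxFace_of_le hx₁ hx.1 (le_of_eq ?_)
    rw [inner_add_left, inner_add_left, real_inner_smul_left, real_inner_smul_left,
      inner_eq_of_mem_maxFace hx₀ hx, hw x₀ hx₀ x hx]

end MaxFace

/-! ### Proper faces lie in facets -/

section Facets

variable {E : Type*} [NormedAddCommGroup E] [InnerProductSpace ℝ E]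

theorem vectorSpan_eq_of_dim_le [FiniteDimensional ℝ E] {A B : Set E} (h : A ⊆ B)
    (hd : dim B ≤ dim A) : vectorSpan ℝ A = vectorSpan ℝ B :=
  Submodule.eq_of_le_of_finrank_le (vectorSpan_mono ℝ h) hd

theorem dim_maxFace_lt [FiniteDimensional ℝ E] {P : Set E} {y : E} (h : maxFace y P ≠ P) :
    dim (maxFace y P) < dim P := by
  by_contra hd
  refine h (maxFace_eq_self_iff.2 ?_)
  rw [← vectorSpan_eq_of_dim_le (maxFace_subset y P) (not_lt.1 hd)]
  exact mem_orthogonal_of_mem_maxFace y P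

theorem finrank_orthogonal_vectorSpan [FiniteDimensional ℝ E] (A : Set E) :
    dim A + finrank ℝ (vectorSpan ℝ A)ᗮ = finrank ℝ E :=
  (vectorSpan ℝ A).finrank_add_finrank_orthogonal

/-- Rotating the functional `y` towards `w` until the exposed face grows. -/
theorem IsPolytope.exists_maxFace_ssubset {P : Set E} (hP : IsPolytope P) {y w : E}
    (hw : w ∈ (vectorSpan ℝ (maxFace y P))ᗮ)
    (hlt : ∃ x ∈ maxFace y P, ∃ z ∈ P, inner ℝ w x < inner ℝ w z) :
    ∃ t : ℝ, 0 < t ∧ maxFace y P ⊂ maxFace (y + t • w) P := by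
  have hP' := hP
  obtain ⟨s, hs, rfl⟩ := hP
  rw [mem_orthogonal_vectorSpan] at hw
  obtain ⟨x, hx, z, hz, hxz⟩ := hlt
  have hsP : ∀ v ∈ s, v ∈ convexHull ℝ (s : Set E) := fun v hv => subset_convexHull ℝ _ hv
  have hi : ∀ (ε : ℝ) z, inner ℝ (y + ε • w) z = inner ℝ y z + ε * inner ℝ w z :=
    fun ε z => by rw [inner_add_left, real_inner_smul_left]
  have hne : (s.filter fun v => inner ℝ w x < inner ℝ w v).Nonempty := by
    by_contra hn
    rw [Finset.not_nonempty_iff_eq_empty, Finset.filter_eq_empty_iff] at hn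
    exact (inner_le_of_mem_convexHull (fun v hv => not_lt.1 (hn hv)) z hz).not_gt hxz
  -- Ratio test: `v₀` is a generator first reached by the rotating maximum, and its ratio is the
  -- required `t`.
  obtain ⟨v₀, hv₀, hmin⟩ := Finset.exists_min_image _
    (fun v => (inner ℝ y x - inner ℝ y v) / (inner ℝ w v - inner ℝ w x)) hne
  rw [Finset.mem_filter] at hv₀
  have hv₀F : v₀ ∉ maxFace y (convexHull ℝ (s : Set E)) := fun h => hv₀.2.ne (hw x hx v₀ h)
  have hd₀ : 0 < inner ℝ w v₀ - inner ℝ w x := sub_pos.2 hv₀.2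
  have hn₀ : 0 < inner ℝ y x - inner ℝ y v₀ := by
    by_contra hn
    exact hv₀F (mem_maxFace_of_le hx (hsP v₀ hv₀.1) (by linarith))
  set t := (inner ℝ y x - inner ℝ y v₀) / (inner ℝ w v₀ - inner ℝ w x) with ht
  have ht0 : 0 < t := div_pos hn₀ hd₀
  have hx' : x ∈ maxFace (y + t • w) (convexHull ℝ (s : Set E)) := by
    refine ⟨hx.1, inner_le_of_mem_convexHull fun v hv => ?_⟩
    rw [hi, hi]
    have hyv := hx.2 v (hsP v hv)
    by_cases hv' : inner ℝ w x < inner ℝ w v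
    · have := hmin v (Finset.mem_filter.2 ⟨hv, hv'⟩)
      rw [le_div_iff₀ (sub_pos.2 hv')] at this
      linarith
    · have := mul_le_mul_of_nonneg_left (not_lt.1 hv') ht0.le
      linarith
  have hsub : maxFace y (convexHull ℝ (s : Set E)) ⊆
      maxFace (y + t • w) (convexHull ℝ (s : Set E)) := fun u hu =>
    mem_maxFace_of_le hx' hu.1 (by
      rw [hi, hi, inner_eq_of_mem_maxFace hx hu, hw x hx u hu])
  refine ⟨t, ht0, hsub, fun h => hv₀F (h ?_)⟩
  refine mem_maxFace_of_le hx' (hsP v₀ hv₀.1) ?_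
  rw [hi, hi]
  have : t * (inner ℝ w v₀ - inner ℝ w x) = inner ℝ y x - inner ℝ y v₀ :=
    div_mul_cancel₀ _ hd₀.ne'
  linarith

/-- Codimension at least two leaves a direction `w` normal to the face but outside `(vectorSpan ℝ
P)ᗮ ⊔ span {y}`. Rotating towards `w` or `-w` enlarges the face, and the choice of `w` prevents the
result from being all of `P`. -/
theorem IsPolytope.exists_maxFace_between [FiniteDimensional ℝ E] {P : Set E}
    (hP : IsPolytope P) {y : E} (hd : dim (maxFace y P) + 1 < dim P) :
    ∃ y', maxFace y P ⊂ maxFace y' P ∧ maxFace y' P ≠ P := by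
  obtain ⟨w, hw, hwn⟩ : ∃ w ∈ (vectorSpan ℝ (maxFace y P))ᗮ,
      w ∉ (vectorSpan ℝ P)ᗮ ⊔ Submodule.span ℝ {y} := by
    refine SetLike.not_le_iff_exists.1 fun hle => ?_
    have h1 := Submodule.finrank_mono hle
    have h2 := Submodule.finrank_add_le_finrank_add_finrank (vectorSpan ℝ P)ᗮ
      (Submodule.span ℝ {y})
    have h3 := finrank_span_le_card (R := ℝ) ({y} : Set E)
    rw [Set.toFinset_singleton, Finset.card_singleton] at h3
    have h4 := finrank_orthogonal_vectorSpan P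
    have h5 := finrank_orthogonal_vectorSpan (maxFace y P)
    omega
  have main : ∀ w' : E, w' ∈ (vectorSpan ℝ (maxFace y P))ᗮ →
      w' ∉ (vectorSpan ℝ P)ᗮ ⊔ Submodule.span ℝ {y} →
      (∃ x ∈ maxFace y P, ∃ z ∈ P, inner ℝ w' x < inner ℝ w' z) →
      ∃ y', maxFace y P ⊂ maxFace y' P ∧ maxFace y' P ≠ P := by
    intro w' hw' hwn' hlt
    obtain ⟨t, ht, hss⟩ := hP.exists_maxFace_ssubset hw' hlt
    refine ⟨_, hss, fun h => hwn' ?_⟩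
    rw [maxFace_eq_self_iff] at h
    have hmem : t⁻¹ • ((y + t • w') - y) ∈ (vectorSpan ℝ P)ᗮ ⊔ Submodule.span ℝ {y} :=
      Submodule.smul_mem _ _ (Submodule.sub_mem _ (Submodule.mem_sup_left h)
        (Submodule.mem_sup_right (Submodule.mem_span_singleton_self y)))
    rwa [add_sub_cancel_left, inv_smul_smul₀ ht.ne'] at hmem
  obtain ⟨x, hx⟩ := hP.maxFace_nonempty y
  obtain ⟨z, hz, hne⟩ : ∃ z ∈ P, inner ℝ w z ≠ inner ℝ w x := by
    by_contra! hn
    exact hwn (Submodule.mem_sup_left (mem_orthogonal_vectorSpan.2 fun a ha b hb => by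
      rw [hn a ha, hn b hb]))
  rcases hne.lt_or_gt with h | h
  · refine main (-w) (Submodule.neg_mem _ hw) (fun h => hwn ?_) ⟨x, hx, z, hz, ?_⟩
    · rwa [Submodule.neg_mem_iff] at h
    · rw [inner_neg_left, inner_neg_left]
      linarith
  · exact main w hw hwn ⟨x, hx, z, hz, h⟩

/-- Every proper face of a polytope is contained in a facet. -/
theorem IsPolytope.exists_isFacet_superset [FiniteDimensional ℝ E] {P : Set E}
    (hP : IsPolytope P) {y : E} (hy : maxFace y P ≠ P) :
    ∃ y', maxFace y P ⊆ maxFace y' P ∧ IsFacet P (maxFace y' P) := by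
  have hfin : {F | IsFace P F ∧ F ≠ P}.Finite := hP.finite_faces.subset fun F hF => hF.1
  obtain ⟨F, hle, hmax⟩ := hfin.exists_le_maximal
    (show maxFace y P ∈ _ from ⟨(isFace_iff hP).2 ⟨y, rfl⟩, hy⟩)
  obtain ⟨hF, hFP⟩ := hmax.prop
  obtain ⟨y', rfl⟩ := (isFace_iff hP).1 hF
  refine ⟨y', hle, hF, ?_⟩
  have hlt := dim_maxFace_lt hFP
  by_contra hne
  obtain ⟨y'', hss, hne'⟩ := hP.exists_maxFace_between (y := y') (by omega)
  exact hss.2 (hmax.le_of_ge ⟨(isFace_iff hP).2 ⟨y'', rfl⟩, hne'⟩ hss.1)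

end Facets

/-! ### Minkowski sums and their faces -/

section Sums

open Classical in
theorem sum_update {ι M : Type*} [Fintype ι] [AddCommGroup M] (g : ι → M) (i : ι) (z : M) :
    ∑ j, Function.update g i z j = ∑ j, g j + (z - g i) := by
  rw [Finset.sum_update_of_mem (Finset.mem_univ i),
    ← Finset.add_sum_erase _ g (Finset.mem_univ i), Finset.sdiff_singleton_eq_erase]
  abel

theorem sum_mem_sum {ι M : Type*} [Fintype ι] [AddCommMonoid M] {P : ι → Set M} {g : ι → M}
    (hg : ∀ i, g i ∈ P i) :
    ∑ i, g i ∈ ∑ i, P i :=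
  (Set.mem_fintype_sum P _).2 ⟨g, hg, rfl⟩

variable {E : Type*} [NormedAddCommGroup E] [InnerProductSpace ℝ E] {ι : Type*} [Fintype ι]

theorem IsPolytope.sum {P : ι → Set E} (hP : ∀ i, IsPolytope (P i)) : IsPolytope (∑ i, P i) := by
  classical
  refine Finset.sum_induction P IsPolytope ?_ ?_ fun i _ => hP i
  · rintro _ _ ⟨s, hs, rfl⟩ ⟨t, ht, rfl⟩
    exact ⟨s + t, hs.add ht, by rw [Finset.coe_add, convexHull_add]⟩
  · exact ⟨{0}, Finset.singleton_nonempty 0, by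
      rw [Finset.coe_singleton, convexHull_singleton]; rfl⟩

theorem sum_mem_maxFace_iff {P : ι → Set E} {y : E} {g : ι → E} (hg : ∀ i, g i ∈ P i) :
    ∑ i, g i ∈ maxFace y (∑ i, P i) ↔ ∀ i, g i ∈ maxFace y (P i) := by
  classical
  constructor
  · intro h i
    refine ⟨hg i, fun z hz => ?_⟩
    have hmem : ∀ j, Function.update g i z j ∈ P j := by
      intro j
      by_cases hj : j = i
      · subst hj; simpa using hz
      · simpa [hj] using hg j
    have := h.2 _ (sum_mem_sum hmem)
    rw [sum_update, inner_add_right, inner_sub_right] at this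
    linarith
  · intro h
    refine ⟨sum_mem_sum hg, fun z hz => ?_⟩
    obtain ⟨u, hu, rfl⟩ := (Set.mem_fintype_sum P z).1 hz
    rw [inner_sum, inner_sum]
    exact Finset.sum_le_sum fun i _ => (h i).2 _ (hu i)

theorem maxFace_sum (y : E) (P : ι → Set E) :
    maxFace y (∑ i, P i) = ∑ i, maxFace y (P i) := by
  ext x
  constructor
  · intro hx
    obtain ⟨g, hg, rfl⟩ := (Set.mem_fintype_sum P x).1 hx.1
    exact sum_mem_sum ((sum_mem_maxFace_iff hg).1 hx)
  · intro hx
    obtain ⟨g, hg, rfl⟩ := (Set.mem_fintype_sum _ x).1 hx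
    exact (sum_mem_maxFace_iff fun i => (hg i).1).2 hg

/-- Inclusions between sums of faces are inherited by the summands. -/
theorem subset_maxFace_of_sum_subset {P G : ι → Set E} {y : E} (hG : ∀ i, G i ⊆ P i)
    (hne : ∀ i, (G i).Nonempty) (h : ∑ i, G i ⊆ maxFace y (∑ i, P i)) (i : ι) :
    G i ⊆ maxFace y (P i) := by
  classical
  intro x hx
  choose g hg using hne
  have hmem : ∀ j, Function.update g i x j ∈ G j := by
    intro j
    by_cases hj : j = i
    · subst hj; simpa using hx
    · simpa [hj] using hg j
  have := (sum_mem_maxFace_iff fun j => hG j (hmem j)).1 (h (sum_mem_sum hmem)) i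
  simpa using this

theorem vectorSpan_sum {F : ι → Set E} (hF : ∀ i, (F i).Nonempty) :
    vectorSpan ℝ (∑ i, F i) = ⨆ i, vectorSpan ℝ (F i) := by
  classical
  apply le_antisymm
  · rw [vectorSpan_def, Submodule.span_le]
    rintro _ ⟨a, ha, b, hb, rfl⟩
    obtain ⟨g, hg, rfl⟩ := (Set.mem_fintype_sum F a).1 ha
    obtain ⟨u, hu, rfl⟩ := (Set.mem_fintype_sum F b).1 hb
    simp only [vsub_eq_sub, ← Finset.sum_sub_distrib]
    exact Submodule.sum_mem _ fun i _ =>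
      Submodule.mem_iSup_of_mem i (vsub_mem_vectorSpan ℝ (hg i) (hu i))
  · refine iSup_le fun i => ?_
    rw [vectorSpan_def, Submodule.span_le]
    rintro _ ⟨a, ha, b, hb, rfl⟩
    choose g hg using hF
    have hmem : ∀ z ∈ F i, ∀ j, Function.update g i z j ∈ F j := by
      intro z hz j
      by_cases hj : j = i
      · subst hj; simpa using hz
      · simpa [hj] using hg j
    have := vsub_mem_vectorSpan ℝ (sum_mem_sum (hmem a ha)) (sum_mem_sum (hmem b hb))
    rw [sum_update, sum_update, vsub_eq_sub, add_sub_add_left_eq_sub, sub_sub_sub_cancel_right]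
      at this
    exact this

/-- If `x ∈ F i` were outside `G i`, separate it by a functional `f`. Replacing the `i`-th of the
`f`-maximal points of the `G j` by `x` exceeds the maximum of `f` on the sum. -/
theorem eq_of_subset_of_sum_eq {G F : ι → Set E} (hGF : ∀ i, G i ⊆ F i)
    (hG : ∀ i, IsCompact (G i)) (hc : ∀ i, Convex ℝ (G i)) (hne : ∀ i, (G i).Nonempty)
    (h : ∑ i, G i = ∑ i, F i) (i : ι) : G i = F i := by
  classical
  refine Set.Subset.antisymm (hGF i) fun x hx => ?_
  by_contra hxG
  obtain ⟨f, u, hf, hu⟩ := geometric_hahn_banach_closed_point (hc i) (hG i).isClosed hxG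
  have hmax : ∀ j, ∃ g ∈ G j, ∀ z ∈ G j, f z ≤ f g := fun j =>
    (hG j).exists_isMaxOn (hne j) f.continuous.continuousOn
  choose g hg hgm using hmax
  have hmem : ∀ j, Function.update g i x j ∈ F j := by
    intro j
    by_cases hj : j = i
    · subst hj; simpa using hx
    · simpa [hj] using hGF j (hg j)
  have hs := sum_mem_sum hmem
  rw [← h] at hs
  obtain ⟨v, hv, hvs⟩ := (Set.mem_fintype_sum G _).1 hs
  have h1 := congrArg f hvs
  rw [sum_update, map_add, map_sub, map_sum, map_sum] at h1
  have h2 : ∑ j, f (v j) ≤ ∑ j, f (g j) := Finset.sum_le_sum fun j _ => hgm j _ (hv j)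
  have h3 := hf _ (hg i)
  linarith

end Sums

/-! ### Unique and exact decompositions -/

section Exactness

variable {E : Type*} [NormedAddCommGroup E] [InnerProductSpace ℝ E]

/-- The decomposition of a face of a Minkowski sum is unique. -/
theorem IsDecomposition.eq_maxFace {r : ℕ} {P : Fin r → Set E} (hP : ∀ i, IsPolytope (P i))
    {y : E} {G : Fin r → Set E} (hG : IsDecomposition P (maxFace y (∑ i, P i)) G) (i : Fin r) :
    G i = maxFace y (P i) := by
  obtain ⟨hface, hsum⟩ := hG
  have hsub : ∀ i, G i ⊆ P i := fun i => (hface i).2.subset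
  refine eq_of_subset_of_sum_eq (subset_maxFace_of_sum_subset hsub (fun i => (hface i).1)
    hsum.symm.subset) (fun i => (hface i).2.isCompact (hP i).isCompact)
    (fun i => (hface i).2.convex (hP i).convex) (fun i => (hface i).1) ?_ i
  rw [← hsum, maxFace_sum]

/-- If the summands are relatively in general position, every proper face decomposes exactly. -/
theorem InRelativeGeneralPosition.dim_maxFace [FiniteDimensional ℝ E] {r : ℕ} {P : Fin r → Set E}
    (hP : ∀ i, IsPolytope (P i)) (hgp : InRelativeGeneralPosition P) {y : E}
    (hy : maxFace y (∑ i, P i) ≠ ∑ i, P i) :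
    dim (maxFace y (∑ i, P i)) = ∑ i, dim (maxFace y (P i)) := by
  obtain ⟨y', hsub, hfacet⟩ := (IsPolytope.sum hP).exists_isFacet_superset hy
  obtain ⟨G, hG, hdim⟩ := hgp _ hfacet
  simp only [hG.eq_maxFace hP] at hdim
  rw [maxFace_sum, dim, vectorSpan_sum fun i => (hP i).maxFace_nonempty y'] at hdim
  rw [maxFace_sum, dim, vectorSpan_sum fun i => (hP i).maxFace_nonempty y]
  refine finrank_iSup_eq_sum_mono (fun i => vectorSpan_mono ℝ ?_) hdim
  refine subset_maxFace_of_sum_subset (fun i => maxFace_subset y (P i))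
    (fun i => (hP i).maxFace_nonempty y) ?_ i
  rwa [← maxFace_sum]

/-- The normal fan of the sum refines that of each summand: functionals exposing the same face of
the sum expose the same face of every `P i`. The value `∅` off the faces of the sum is never used.
-/
theorem exists_component {ι : Type*} [Fintype ι] {P : ι → Set E} (hP : ∀ i, IsPolytope (P i)) :
    ∃ comp : ι → Set E → Set E, ∀ i y, comp i (maxFace y (∑ i, P i)) = maxFace y (P i) := by
  classical
  have key : ∀ y y', maxFace y (∑ i, P i) = maxFace y' (∑ i, P i) →
      ∀ i, maxFace y (P i) ⊆ maxFace y' (P i) := fun y y' h =>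
    subset_maxFace_of_sum_subset (fun i => maxFace_subset y (P i))
      (fun i => (hP i).maxFace_nonempty y) (by rw [← maxFace_sum, h])
  refine ⟨fun i F => if h : ∃ y, maxFace y (∑ i, P i) = F then maxFace h.choose (P i) else ∅,
    fun i y => ?_⟩
  have h : ∃ y', maxFace y' (∑ i, P i) = maxFace y (∑ i, P i) := ⟨y, rfl⟩
  simp only [dif_pos h]
  exact Set.Subset.antisymm (key _ _ h.choose_spec i) (key _ _ h.choose_spec.symm i)

end Exactness

/-! ### Alternating sums over faces -/

section FaceSums

variable {E : Type*} [NormedAddCommGroup E] [InnerProductSpace ℝ E] [FiniteDimensional ℝ E]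

/-- If a relatively open convex set is a union of relatively open normal cones of `P`, its Euler
characteristic is an alternating sum over the corresponding faces. -/
theorem IsPolytope.sum_neg_one_pow_dim {P : Set E} (hP : IsPolytope P) (J : Finset (Set E))
    (hJ : ∀ F ∈ J, IsFace P F) {C : Set E} {W : Submodule ℝ E} (hC : IsRelOpenConvex W C)
    (hmem : ∀ y, y ∈ C ↔ maxFace y P ∈ J) :
    ∑ F ∈ J, (-1 : ℤ) ^ dim F = (-1) ^ (finrank ℝ E + finrank ℝ W) := by
  rw [pow_add, neg_one_pow_finrank_eq_sum J hC (fun F => {y | maxFace y P = F})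
    (fun F => (vectorSpan ℝ F)ᗮ), Finset.mul_sum]
  · refine Finset.sum_congr rfl fun F _ => ?_
    rw [← finrank_orthogonal_vectorSpan F, pow_add, mul_assoc, ← pow_add, ← two_mul, pow_mul,
      neg_one_sq, one_pow, mul_one]
  · intro F hF
    obtain ⟨y, rfl⟩ := (isFace_iff hP).1 (hJ F hF)
    exact hP.isRelOpenConvex_normalCone y
  · rintro F hF y rfl
    exact (hmem y).2 hF
  · exact fun y hy => ⟨maxFace y P, ⟨(hmem y).1 hy, rfl⟩, fun F hF => hF.2.symm⟩

/-- The finite set of nonempty faces of a polytope. -/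
noncomputable def IsPolytope.faces {P : Set E} (hP : IsPolytope P) : Finset (Set E) :=
  hP.finite_faces.toFinset

theorem IsPolytope.mem_faces {P F : Set E} (hP : IsPolytope P) :
    F ∈ hP.faces ↔ ∃ y, maxFace y P = F := by
  rw [IsPolytope.faces, Set.Finite.mem_toFinset, ← isFace_iff hP]
  rfl

theorem IsPolytope.self_mem_faces {P : Set E} (hP : IsPolytope P) : P ∈ hP.faces :=
  hP.mem_faces.2 ⟨0, maxFace_eq_self_iff.2 (Submodule.zero_mem _)⟩

/-- Euler's formula. -/
theorem IsPolytope.sum_faces {P : Set E} (hP : IsPolytope P) :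
    ∑ F ∈ hP.faces, (-1 : ℤ) ^ dim F = 1 := by
  have huniv : IsRelOpenConvex (⊤ : Submodule ℝ E) (Set.univ : Set E) :=
    ⟨Set.univ_nonempty, convex_univ, fun _ _ _ _ => trivial, fun _ _ _ _ => ⟨1, one_pos, trivial⟩⟩
  rw [hP.sum_neg_one_pow_dim hP.faces (fun F hF => (isFace_iff hP).2 (hP.mem_faces.1 hF)) huniv
    (fun y => ⟨fun _ => hP.mem_faces.2 ⟨y, rfl⟩, fun _ => trivial⟩), finrank_top, ← two_mul,
    pow_mul, neg_one_sq, one_pow]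

open Classical in
/-- The faces of a Minkowski sum with a given component in one summand. -/
theorem sum_neg_one_pow_dim_component {ι : Type*} [Fintype ι] {P : ι → Set E}
    (hP : ∀ i, IsPolytope (P i)) {comp : Set E → Set E} {i : ι}
    (hcomp : ∀ y, comp (maxFace y (∑ i, P i)) = maxFace y (P i)) {G : Set E}
    (hG : G ∈ (hP i).faces) :
    ∑ F ∈ (IsPolytope.sum hP).faces with comp F = G, (-1 : ℤ) ^ dim F = (-1) ^ dim G := by
  obtain ⟨y₀, rfl⟩ := (hP i).mem_faces.1 hG
  rw [(IsPolytope.sum hP).sum_neg_one_pow_dim _ ?_ ((hP i).isRelOpenConvex_normalCone y₀) ?_,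
    ← finrank_orthogonal_vectorSpan (maxFace y₀ (P i)), add_assoc, ← two_mul, pow_add, pow_mul,
    neg_one_sq, one_pow, mul_one]
  · intro F hF
    exact (isFace_iff (IsPolytope.sum hP)).2 ((IsPolytope.sum hP).mem_faces.1 (Finset.mem_filter.1 hF).1)
  · intro y
    rw [Finset.mem_filter, hcomp]
    exact ⟨fun h => ⟨(IsPolytope.sum hP).mem_faces.2 ⟨y, rfl⟩, h⟩, fun h => h.2⟩

open Classical in
/-- The alternating sum of the dimensions of the proper faces is additive. -/
theorem sum_neg_one_pow_mul_dim {r : ℕ} {P : Fin r → Set E} (hP : ∀ i, IsPolytope (P i))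
    (hd : ∀ i, dim (P i) = dim (∑ i, P i)) (hgp : InRelativeGeneralPosition P) :
    ∑ F ∈ (IsPolytope.sum hP).faces.erase (∑ i, P i), (-1 : ℤ) ^ dim F * dim F =
      ∑ i, ∑ G ∈ (hP i).faces.erase (P i), (-1 : ℤ) ^ dim G * dim G := by
  obtain ⟨comp, hcomp⟩ := exists_component hP
  -- Equal dimensions force equal direction spaces, so a face of the sum is proper exactly when each
  -- of its components is.
  have hspan : ∀ i, vectorSpan ℝ (P i) = vectorSpan ℝ (∑ i, P i) := fun i => by
    refine Submodule.eq_of_le_of_finrank_eq ?_ (hd i)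
    rw [vectorSpan_sum fun i => (hP i).nonempty]
    exact le_iSup (fun i => vectorSpan ℝ (P i)) i
  have hproper : ∀ y i, maxFace y (P i) = P i ↔ maxFace y (∑ i, P i) = ∑ i, P i := fun y i => by
    rw [maxFace_eq_self_iff, maxFace_eq_self_iff, hspan]
  have h1 : ∀ F ∈ (IsPolytope.sum hP).faces.erase (∑ i, P i),
      (-1 : ℤ) ^ dim F * dim F = ∑ i, (-1 : ℤ) ^ dim F * dim (comp i F) := by
    intro F hF
    obtain ⟨hF, hFf⟩ := Finset.mem_erase.1 hF
    obtain ⟨y, rfl⟩ := (IsPolytope.mem_faces _).1 hFf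
    rw [← Finset.mul_sum]
    simp only [hcomp]
    rw [hgp.dim_maxFace hP hF, Nat.cast_sum]
  rw [Finset.sum_congr rfl h1, Finset.sum_comm]
  refine Finset.sum_congr rfl fun i _ => ?_
  have hmaps : ∀ F ∈ (IsPolytope.sum hP).faces.erase (∑ i, P i),
      comp i F ∈ (hP i).faces.erase (P i) := by
    intro F hF
    obtain ⟨hF, hFf⟩ := Finset.mem_erase.1 hF
    obtain ⟨y, rfl⟩ := (IsPolytope.mem_faces _).1 hFf
    rw [hcomp]
    exact Finset.mem_erase.2 ⟨fun h => hF ((hproper y i).1 h), (hP i).mem_faces.2 ⟨y, rfl⟩⟩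
  rw [← Finset.sum_fiberwise_of_maps_to hmaps]
  refine Finset.sum_congr rfl fun G hG => ?_
  obtain ⟨hGP, hGf⟩ := Finset.mem_erase.1 hG
  rw [← sum_neg_one_pow_dim_component hP (hcomp i) hGf, Finset.sum_mul]
  refine Finset.sum_congr ?_ fun F hF => by rw [(Finset.mem_filter.1 hF).2]
  -- The sum itself has component `P i ≠ G`, as the zero functional shows, so removing it does not
  -- change the fibre over `G`.
  rw [Finset.filter_erase, Finset.erase_eq_of_notMem]
  intro hmem
  have h0 := hcomp i 0
  have hself : ∀ Q : Set E, maxFace 0 Q = Q := fun Q =>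
    maxFace_eq_self_iff.2 (Submodule.zero_mem _)
  rw [hself, hself, (Finset.mem_filter.1 hmem).2] at h0
  exact hGP h0

open Classical in
theorem IsPolytope.sum_range_mul_fVec {P : Set E} (hP : IsPolytope P) (f : ℕ → ℝ) :
    ∑ k ∈ Finset.range (dim P), f k * (fVec P k : ℝ) = ∑ F ∈ hP.faces.erase P, f (dim F) := by
  have hmaps : ∀ F ∈ hP.faces.erase P, dim F ∈ Finset.range (dim P) := by
    intro F hF
    obtain ⟨hF, hFf⟩ := Finset.mem_erase.1 hF
    obtain ⟨y, rfl⟩ := hP.mem_faces.1 hFf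
    exact Finset.mem_range.2 (dim_maxFace_lt hF)
  rw [← Finset.sum_fiberwise_of_maps_to hmaps]
  refine Finset.sum_congr rfl fun k hk => ?_
  have hset : {F : Set E | IsFace P F ∧ dim F = k} =
      ((hP.faces.erase P).filter fun F => dim F = k : Finset (Set E)) := by
    ext F
    rw [Finset.mem_coe, Finset.mem_filter, Finset.mem_erase, hP.mem_faces, ← isFace_iff hP]
    refine ⟨fun h => ⟨⟨?_, h.1⟩, h.2⟩, fun h => ⟨h.1.2, h.2⟩⟩
    rintro rfl
    exact (Finset.mem_range.1 hk).ne h.2.symm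
  rw [fVec, hset, Set.ncard_coe_finset,
    Finset.sum_congr rfl fun F hF => by rw [(Finset.mem_filter.1 hF).2],
    Finset.sum_const, nsmul_eq_mul, mul_comm]

open Classical in
theorem IsPolytope.sum_range_neg_one_pow_mul {P : Set E} (hP : IsPolytope P) (a : ℝ) :
    ∑ k ∈ Finset.range (dim P), (-1 : ℝ) ^ k * ((k : ℝ) + a) * (fVec P k : ℝ) =
      ((∑ F ∈ hP.faces.erase P, (-1 : ℤ) ^ dim F * dim F : ℤ) : ℝ)
        + a * (1 - (-1) ^ dim P) := by
  rw [hP.sum_range_mul_fVec fun k => (-1 : ℝ) ^ k * ((k : ℝ) + a)]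
  have h := hP.sum_faces
  -- Splitting off `P` in Euler's formula leaves `1 - (-1) ^ dim P` for the proper faces.
  rw [← Finset.add_sum_erase _ _ hP.self_mem_faces] at h
  have h' := congrArg (Int.cast : ℤ → ℝ) h
  push_cast at h' ⊢
  simp only [mul_add]
  rw [Finset.sum_add_distrib, ← Finset.sum_mul, eq_sub_of_add_eq' h']
  ring

end FaceSums

end MinkowskiFaces

theorem corollary3 {E : Type*} [NormedAddCommGroup E] [InnerProductSpace ℝ E]
    [FiniteDimensional ℝ E] (r d : ℕ) (P : Fin r → Set E)
    (hP : ∀ i, MinkowskiFaces.IsPolytope (P i))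
    (hd : ∀ i, MinkowskiFaces.dim (P i) = d)
    (hsum : MinkowskiFaces.dim (∑ i, P i) = d)
    (hgp : MinkowskiFaces.InRelativeGeneralPosition P) (a : ℝ) :
    ∑ k ∈ Finset.range d, (-1 : ℝ) ^ k * ((k : ℝ) + a) * (MinkowskiFaces.fDelta P k : ℝ)
      = a * (1 - (r : ℝ)) * (1 - (-1 : ℝ) ^ d) := by
  have hS := (MinkowskiFaces.IsPolytope.sum hP).sum_range_neg_one_pow_mul a
  have hi := fun i => (hP i).sum_range_neg_one_pow_mul a
  rw [hsum] at hS
  simp only [hd] at hi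
  have hadd := MinkowskiFaces.sum_neg_one_pow_mul_dim hP (fun i => (hd i).trans hsum.symm) hgp
  have hsplit : ∑ k ∈ Finset.range d,
      (-1 : ℝ) ^ k * ((k : ℝ) + a) * (MinkowskiFaces.fDelta P k : ℝ) =
      ∑ k ∈ Finset.range d,
        (-1 : ℝ) ^ k * ((k : ℝ) + a) * (MinkowskiFaces.fVec (∑ i, P i) k : ℝ) -
      ∑ i, ∑ k ∈ Finset.range d,
        (-1 : ℝ) ^ k * ((k : ℝ) + a) * (MinkowskiFaces.fVec (P i) k : ℝ) := by
    rw [Finset.sum_comm, ← Finset.sum_sub_distrib]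
    refine Finset.sum_congr rfl fun k _ => ?_
    rw [← Finset.mul_sum, ← mul_sub, MinkowskiFaces.fDelta]
    push_cast
    rfl
  -- The dimension sums cancel; `a * (1 - (-1) ^ d)` remains, once for the sum and `r` times, with
  -- opposite sign, for the summands.
  rw [hsplit, hS, hadd, Finset.sum_congr rfl fun i _ => hi i, Finset.sum_add_distrib,
    Int.cast_sum, Finset.sum_const, Finset.card_univ, Fintype.card_fin, nsmul_eq_mul]
  ring
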